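/- **Terms.** Fix a set $\mathcal K_+$ of positive instructions, which contains pairwise distinct primitive integers $\overline n$ ($n\in\mathbb N$), and a set $\mathcal K_-$ of negative instructions. Positive variables are written $x$, negative ones $\alpha$, and $\kappa,\kappa'$ stand for variables of any polarity. Values $V$, negative terms $t^-$, positive terms $t^+$ and commands $c$ are given by $$V^+::=x\mid k_+\mid(V,V')\mid\{V\},\quad t^-::=\alpha\mid k_-\mid\mu(\kappa,\kappa').c\mid\mu\{\kappa\}.c\mid\mu x.c,\quad t^+::=V^+\mid\mu\alpha.c,\quad c::=\langle t^+|t^-\rangle=\langle t^-|t^+\rangle ,$$ where $k_\pm\in\mathcal K_\pm$, and a value $V$ is a $V^+$ or a $t^-$. For arbitrary terms $t,u$ that are not both values, $(t,u)$ abbreviates $\mu\alpha.\langle t|\mu\kappa.\langle u|\mu\kappa'.\langle(\kappa,\kappa')|\alpha\rangle\rangle\rangle$. Below, terms and commands are closed. **Countdown machine.** Negative commands are the $\langle t^\ominus|u^+\rangle$, where $t$ is a term of either polarity marked by $\ominus$ and $u^+$ is a positive term. Forcing commands are the negative commands $\langle t^\ominus|u\rangle\{K\}:=\langle t^\ominus|(u,K)\rangle$,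 where $K$ is a term and $t,u$ are terms of opposite polarities; $\langle t^\ominus|u\rangle\{K\}$ and $\langle u^\ominus|t\rangle\{K\}$ are identified. For a command $c=\langle t^+|u^-\rangle$ let $c^\bullet\{K\}:=\langle (u^-)^\ominus|t^+\rangle\{K\}$. The reduction is $$\begin{aligned}\langle (t^-)^\ominus|\mu\alpha.c\rangle\{\overline n\}&\to_\bullet (c[t^- /\alpha])^\bullet\{\overline n\},\\ \langle(\mu x.c)^\ominus|V^+\rangle\{\overline n\}&\to_\bullet (c[V^+/x])^\bullet\{\overline n\},\\ \langle(\mu(\kappa,\kappa').c)^\ominus|(V_1,V_2)\rangle\{\overline{n+1}\}&\to_\bullet (c[V_1/\kappa,V_2/\kappa'])^\bullet\{\overline n\},\\ \langle(\mu\{\kappa\}.c)^\ominus|\{V\}\rangle\{\overline{n+1}\}&\to_\bullet (c[V/\kappa])^\bullet\{\overline n\},\end{aligned}$$ where substituted values have the polarity of the variable. Let $\bot\!\!\!\bot^\bullet$ be any set of forcing commands (compatible with the identification) that is closed under anti-evaluation: $c\to_\bullet c'\in\bot\!\!\!\bot^\bullet$ implies $c\in\bot\!\!\!\bot^\bullet$.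 **Interpretations.** Let $M$ be a commutative monoid of weights, and let there be given a *negative side* and an orthogonality relation between weighted positive terms and weighted elements of the negative side. We use two instances. * *Countdown:* $M$ is trivial (weights are omitted), the negative side consists of the marked terms $t^\ominus$ for all terms $t$ of either polarity, and $u^+\perp t^\ominus$ iff $\langle t^\ominus|u^+\rangle\in\bot\!\!\!\bot^\bullet$. * *Quantitative:* $M=(\mathbb N,+,0)$, the negative side consists of the negative terms, and $(t^+,p)\perp(u^-,q)$ iff $(\langle t^+|u^-\rangle,p+q)\in\bot\!\!\!\bot^\circ$, where $$\bot\!\!\!\bot^\circ=\{(c,p)\mid c^\bullet\{\overline n\}\in\bot\!\!\!\bot^\bullet\text{ for all }n\ge p\}$$ is the quantitative pole induced by $\bot\!\!\!\bot^\bullet$. For sets $X,Y$ of weighted terms (a mark $\ominus$ being ignored) put $X\otimes Y=\{((V,W),p+q)\mid (V,p)\in X,(W,q)\in Y\}$ and $\downarrow X=\{(\{V\},p)\mid(V,p)\in X\}$, where $V,W$ are values. A *positive propositional domain* $\mathcal D^\oplus$ is a set of sets of weighted positive values, closed under arbitrary unions and under intersections of non-empty families, and such that $X\otimes Y,\ \downarrow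 X\in\mathcal D^\oplus$ for all $X,Y\in\mathcal D^\oplus\cup\mathcal D^\ominus$, where $\mathcal D^\ominus=\{X^\perp\mid X\in\mathcal D^\oplus\}$. The kinds $\iota$, $o^+$, $o^-$ and $\sigma\to\tau$ are interpreted by $\mathbb N$, $\mathcal D^\oplus$, $\mathcal D^\ominus$ and the function space. A total valuation maps each variable of each kind to an element of the interpretation of that kind. Under a valuation $\rho$, constructors are interpreted by: $|x|=\rho(x)$; $\lambda$-abstraction, application, zero, successor and the recursor $rec$ as usual; $|A\otimes B|=|A|\otimes|B|$; $|\downarrow A|=\downarrow|A|$; for positive $P$, $|\exists x.P|$ and $|\forall x.P|$ are the union and the intersection of the values of $|P|$ over all values of $x$; $|\langle T=U\rangle A|=|A|$ if $|T|=|U|$, and otherwise $\emptyset$ if $A$ is positive, $\emptyset^\perp$ if $A$ is negative; all other negative formulas through duality, $|P^\perp|=|P|^\perp$ for positive $P$, with $A\wp B=(A^\perp\otimes B^\perp)^\perp$, $\uparrow A=(\downarrow A^\perp)^\perp$, $\forall x.N=(\exists x.N^\perp)^\perp$, $\exists x.N=(\forall x.N^\perp)^\perp$ for negative $N$. Let $\|A\|=|A|^{\perp\perp}$;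 a weighted term *realizes* $A$ iff it belongs to $\|A\|$. Realizability is written $\Vdash^\bullet$ in the countdown instance and $\Vdash^\circ$ in the quantitative one. **Forcing.** Formulas of MAL (multiplicative affine logic, with par written $\wp$) are positive or negative: $$P::=X\mid A\otimes B\mid\ \downarrow A,\qquad N::=X^\perp\mid A\wp B\mid\ \uparrow A,$$ where $A,B$ have either polarity. Let $\mathcal C[\cdot]$ be a predicate constant of kind $\iota\to o^+$, interpreted in the countdown instance by $|\mathcal C[p]|=\{\overline n\mid p\le n\}$, and let $r+r'$ be addition, defined by $rec$. For a predicate $Z$ of kind $\iota\to o^\pm$ put $$\overline Z=\lambda r.\forall r'.\,Z(r')\multimap\mathcal C[r+r']^\perp ,\qquad A\multimap B=A^\perp\wp B .$$ To each MAL variable $X$ associate a variable $X^{\iota\to o^+}$, and define $X^*=X^{\iota\to o^+}$, $(A\otimes B)^*=\lambda r.\exists p_1.\exists p_2.\langle r=p_1+p_2\rangle(A^*(p_1)\otimes B^*(p_2))$, $(\downarrow A)^*=\lambda r.\downarrow A^*(r)$, and $N^*=\overline{(N^\perp)^*}$ for negative $N$. The integer linear forcing translation is $(p\Vdash_f P)=\overline{\overline{P^*}}(p)$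 for positive $P$ and $(p\Vdash_f N)=N^*(p)$ for negative $N$. For $p\in\mathbb N$, $\underline p=s^p0$ is the corresponding individual. **Theorem (Connection theorem).** Let $\bot\!\!\!\bot^\bullet$ be as above. Let $\mathcal D^\oplus$ be a positive propositional domain for the countdown instance that contains all the sets $|\mathcal C[p]|$, $p\in\mathbb N$, and let $\rho^\bullet$ be a total valuation over it. Put $\rho^\circ(X)=\{(t,p)\mid t\in\rho^\bullet(X^{\iota\to o^+})(p)\}$, and let $\Vdash^\circ$ be taken with respect to any positive propositional domain for the quantitative instance and any total valuation over it whose value at each MAL variable $X$ is $\rho^\circ(X)$. Then for every MAL formula $C$ such that $\rho^\circ(X)\ne\emptyset$ for every variable $X$ occurring in $C$, every term $t$ and every $p\in\mathbb N$, where, in case $\bot\!\!\!\bot^\circ=\emptyset$, the term $t$ is required to have the polarity of $C$, $$t\Vdash^\bullet(\underline p\Vdash_f C)\iff (t,p)\Vdash^\circ C .$$ -/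

import Mathlib

/-! # Term syntax

Terms are considered modulo renaming of bound variables, hence they are represented by well-scoped
de Bruijn terms.  A context is the list of the polarities of the variables in scope. -/

/-- Polarities. -/
inductive Pol : Type where
  | pos : Pol
  | neg : Pol
  deriving DecidableEq

/-- The opposite polarity. -/
@[reducible] def Pol.dual : Pol → Pol
  | .pos => .neg
  | .neg => .pos

/-- `TVar Γ π`: the variables of polarity `π` in the context `Γ`. -/
inductive TVar : List Pol → Pol → Type where
  | zero {Γ : List Pol} {π : Pol} : TVar (π :: Γ) π
  | succ {Γ : List Pol} {π ϖ : Pol} : TVar Γ π → TVar (ϖ :: Γ) π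

mutual

/-- `Val I π Γ`: the values of polarity `π` with free variables in `Γ`; every negative term is a
value, so `Val I .neg Γ` is the type of all negative terms.  `I .pos` and `I .neg` are the sets of
positive and negative instructions other than the primitive integers. -/
inductive Val (I : Pol → Type) : Pol → List Pol → Type where
  /-- a variable `x` or `α` -/
  | var {π : Pol} {Γ : List Pol} (κ : TVar Γ π) : Val I π Γ
  /-- an instruction -/
  | inst {π : Pol} {Γ : List Pol} (k : I π) : Val I π Γ
  /-- the primitive integer `n̄`, a positive instruction -/
  | int {Γ : List Pol} (n : ℕ) : Val I .pos Γ
  /-- `(V, V')` -/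
  | pair {π ϖ : Pol} {Γ : List Pol} (V : Val I π Γ) (W : Val I ϖ Γ) : Val I .pos Γ
  /-- `{V}` -/
  | box {π : Pol} {Γ : List Pol} (V : Val I π Γ) : Val I .pos Γ
  /-- `μ(κ, κ').c`; the last variable of the context of `c` (index zero) is `κ'` -/
  | muPair {Γ : List Pol} (π ϖ : Pol) (c : Cmd I (ϖ :: π :: Γ)) : Val I .neg Γ
  /-- `μ{κ}.c` -/
  | muBox {Γ : List Pol} (π : Pol) (c : Cmd I (π :: Γ)) : Val I .neg Γ
  /-- `μx.c` -/
  | muPos {Γ : List Pol} (c : Cmd I (.pos :: Γ)) : Val I .neg Γ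

/-- Positive terms. -/
inductive PTerm (I : Pol → Type) : List Pol → Type where
  /-- a positive value -/
  | val {Γ : List Pol} (V : Val I .pos Γ) : PTerm I Γ
  /-- `μα.c` -/
  | mu {Γ : List Pol} (c : Cmd I (.neg :: Γ)) : PTerm I Γ

/-- Commands.  As `⟨t|u⟩` and `⟨u|t⟩` are identified, the positive term is written first. -/
inductive Cmd (I : Pol → Type) : List Pol → Type where
  | cut {Γ : List Pol} (t : PTerm I Γ) (u : Val I .neg Γ) : Cmd I Γ

end

/-- Terms; closed terms are the elements of `Term I []`. -/
inductive Term (I : Pol → Type) (Γ : List Pol) : Type where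
  | pos (t : PTerm I Γ) : Term I Γ
  | neg (t : Val I .neg Γ) : Term I Γ

/-- The polarity of a term. -/
def Term.pol {I : Pol → Type} {Γ : List Pol} : Term I Γ → Pol
  | .pos _ => .pos
  | .neg _ => .neg

/-- A value as a term. -/
def Val.toTerm {I : Pol → Type} {Γ : List Pol} : {π : Pol} → Val I π Γ → Term I Γ
  | .pos, V => .pos (.val V)
  | .neg, V => .neg V

/-! ## Renaming and substitution -/

/-- Renamings. -/
abbrev Ren (Γ Δ : List Pol) : Type := ∀ π : Pol, TVar Γ π → TVar Δ π

/-- The extension of a renaming under a binder. -/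
def Ren.lift {Γ Δ : List Pol} (f : Ren Γ Δ) (ϖ : Pol) : Ren (ϖ :: Γ) (ϖ :: Δ)
  | _, .zero => .zero
  | _, .succ κ => .succ (f _ κ)

mutual

/-- Renaming in a value. -/
def Val.ren {I : Pol → Type} : {π : Pol} → {Γ Δ : List Pol} → Ren Γ Δ → Val I π Γ → Val I π Δ
  | _, _, _, f, .var κ => .var (f _ κ)
  | _, _, _, _, .inst k => .inst k
  | _, _, _, _, .int n => .int n
  | _, _, _, f, .pair V W => .pair (V.ren f) (W.ren f)
  | _, _, _, f, .box V => .box (V.ren f)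
  | _, _, _, f, .muPair π ϖ c => .muPair π ϖ (c.ren ((f.lift π).lift ϖ))
  | _, _, _, f, .muBox π c => .muBox π (c.ren (f.lift π))
  | _, _, _, f, .muPos c => .muPos (c.ren (f.lift .pos))

/-- Renaming in a positive term. -/
def PTerm.ren {I : Pol → Type} : {Γ Δ : List Pol} → Ren Γ Δ → PTerm I Γ → PTerm I Δ
  | _, _, f, .val V => .val (V.ren f)
  | _, _, f, .mu c => .mu (c.ren (f.lift .neg))

/-- Renaming in a command. -/
def Cmd.ren {I : Pol → Type} : {Γ Δ : List Pol} → Ren Γ Δ → Cmd I Γ → Cmd I Δ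
  | _, _, f, .cut t u => .cut (t.ren f) (u.ren f)

end

/-- Simultaneous substitutions of values for variables, of matching polarities. -/
abbrev Subst (I : Pol → Type) (Γ Δ : List Pol) : Type := ∀ π : Pol, TVar Γ π → Val I π Δ

/-- The extension of a substitution under a binder. -/
def Subst.lift {I : Pol → Type} {Γ Δ : List Pol} (s : Subst I Γ Δ) (ϖ : Pol) :
    Subst I (ϖ :: Γ) (ϖ :: Δ)
  | _, .zero => .var .zero
  | _, .succ κ => (s _ κ).ren (fun _ => .succ)

/-- The substitution `s, V/κ`, where `κ` is the last variable. -/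
def Subst.snoc {I : Pol → Type} {Γ Δ : List Pol} {ϖ : Pol} (s : Subst I Γ Δ) (V : Val I ϖ Δ) :
    Subst I (ϖ :: Γ) Δ
  | _, .zero => V
  | _, .succ κ => s _ κ

/-- The substitution with empty domain. -/
def Subst.nil {I : Pol → Type} {Δ : List Pol} : Subst I [] Δ :=
  fun _ κ => nomatch κ

mutual

/-- Capture-avoiding substitution in a value. -/
def Val.sub {I : Pol → Type} : {π : Pol} → {Γ Δ : List Pol} → Subst I Γ Δ → Val I π Γ → Val I π Δ
  | _, _, _, s, .var κ => s _ κ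
  | _, _, _, _, .inst k => .inst k
  | _, _, _, _, .int n => .int n
  | _, _, _, s, .pair V W => .pair (V.sub s) (W.sub s)
  | _, _, _, s, .box V => .box (V.sub s)
  | _, _, _, s, .muPair π ϖ c => .muPair π ϖ (c.sub ((s.lift π).lift ϖ))
  | _, _, _, s, .muBox π c => .muBox π (c.sub (s.lift π))
  | _, _, _, s, .muPos c => .muPos (c.sub (s.lift .pos))

/-- Capture-avoiding substitution in a positive term. -/
def PTerm.sub {I : Pol → Type} : {Γ Δ : List Pol} → Subst I Γ Δ → PTerm I Γ → PTerm I Δ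
  | _, _, s, .val V => .val (V.sub s)
  | _, _, s, .mu c => .mu (c.sub (s.lift .neg))

/-- Capture-avoiding substitution in a command. -/
def Cmd.sub {I : Pol → Type} : {Γ Δ : List Pol} → Subst I Γ Δ → Cmd I Γ → Cmd I Δ
  | _, _, s, .cut t u => .cut (t.sub s) (u.sub s)

end

/-- `c[V/κ]`, for a closed value `V`. -/
def Cmd.inst1 {I : Pol → Type} {π : Pol} (c : Cmd I [π]) (V : Val I π []) : Cmd I [] :=
  c.sub (Subst.nil.snoc V)

/-- `c[V/κ, W/κ']`, for closed values `V` and `W`. -/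
def Cmd.inst2 {I : Pol → Type} {π ϖ : Pol} (c : Cmd I [ϖ, π]) (V : Val I π []) (W : Val I ϖ []) :
    Cmd I [] :=
  c.sub ((Subst.nil.snoc V).snoc W)

/-! ## Pairs of arbitrary terms -/

/-- Weakening of a term by one variable. -/
def Term.wk {I : Pol → Type} {Γ : List Pol} (ϖ : Pol) : Term I Γ → Term I (ϖ :: Γ)
  | .pos t => .pos (t.ren (fun _ => .succ))
  | .neg t => .neg (t.ren (fun _ => .succ))

/-- The command `⟨t | μκ.c⟩`, where `κ` has the polarity of `t`. -/
def Term.cutMu {I : Pol → Type} {Γ : List Pol} : (t : Term I Γ) → Cmd I (t.pol :: Γ) → Cmd I Γ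
  | .pos t, c => .cut t (.muPos c)
  | .neg t, c => .cut (.mu c) t

/-- The pair `(t, u)` of two terms.  When `t` and `u` are not both values, it is the abbreviation
`μα.⟨t | μκ.⟨u | μκ'.⟨(κ, κ') | α⟩⟩⟩`. -/
def Term.pair {I : Pol → Type} {Γ : List Pol} : Term I Γ → Term I Γ → PTerm I Γ
  | .pos (.val V), .pos (.val W) => .val (.pair V W)
  | .pos (.val V), .neg W => .val (.pair V W)
  | .neg V, .pos (.val W) => .val (.pair V W)
  | .neg V, .neg W => .val (.pair V W)
  | t, u =>
    .mu ((t.wk .neg).cutMu (((u.wk .neg).wk (t.wk .neg).pol).cutMu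
      (.cut (.val (.pair (.var (.succ .zero)) (.var .zero))) (.var (.succ (.succ .zero))))))

/-! # The countdown machine -/

/-- The negative command `⟨t⊖ | u⟩`, where `t` is any closed term and `u` is a closed positive
term; the mark `⊖` is implicit. -/
structure NegCommand (I : Pol → Type) : Type where
  left : Term I []
  right : PTerm I []

/-- `⟨t⊖ | u⟩{K}`, that is, `⟨t⊖ | (u, K)⟩`. -/
def NegCommand.counter {I : Pol → Type} (t u K : Term I []) : NegCommand I :=
  ⟨t, Term.pair u K⟩

/-- Forcing commands: the negative commands `⟨t⊖ | (u, K)⟩`, where `t` and `u` have opposite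
polarities. -/
def NegCommand.IsForcing {I : Pol → Type} (c : NegCommand I) : Prop :=
  ∃ t u K : Term I [], u.pol = t.pol.dual ∧ c = .counter t u K

/-- The closed term `n̄`. -/
def Term.int {I : Pol → Type} (n : ℕ) : Term I [] := .pos (.val (.int n))

/-- The forcing command `⟨u⊖ | (t, K)⟩` built from the closed command `⟨t|u⟩`
(`t` positive, `u` negative). -/
def Cmd.forcing {I : Pol → Type} : Cmd I [] → Term I [] → NegCommand I
  | .cut t u, K => .counter (.neg u) (.pos t) K

/-- One step of the countdown machine. -/
inductive CountdownStep {I : Pol → Type} : NegCommand I → NegCommand I → Prop where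
  | mu (c : Cmd I [.neg]) (t : Val I .neg []) (n : ℕ) :
      CountdownStep (.counter (.neg t) (.pos (.mu c)) (.int n)) ((c.inst1 t).forcing (.int n))
  | muPos (c : Cmd I [.pos]) (V : Val I .pos []) (n : ℕ) :
      CountdownStep (.counter (.neg (.muPos c)) (.pos (.val V)) (.int n))
        ((c.inst1 V).forcing (.int n))
  | pair {π ϖ : Pol} (c : Cmd I [ϖ, π]) (V : Val I π []) (W : Val I ϖ []) (n : ℕ) :
      CountdownStep (.counter (.neg (.muPair π ϖ c)) (.pos (.val (.pair V W))) (.int (n + 1)))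
        ((c.inst2 V W).forcing (.int n))
  | box {π : Pol} (c : Cmd I [π]) (V : Val I π []) (n : ℕ) :
      CountdownStep (.counter (.neg (.muBox π c)) (.pos (.val (.box V))) (.int (n + 1)))
        ((c.inst1 V).forcing (.int n))

/-- A pole of the countdown machine: a set of forcing commands (taken modulo the identification of
`⟨t⊖ | u⟩{K}` with `⟨u⊖ | t⟩{K}`) that is closed under anti-evaluation. -/
structure CountdownPole (I : Pol → Type) : Type where
  carrier : Set (NegCommand I)
  isForcing : ∀ c ∈ carrier, c.IsForcing
  swap : ∀ t u K : Term I [], u.pol = t.pol.dual →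
    NegCommand.counter t u K ∈ carrier → NegCommand.counter u t K ∈ carrier
  antiEval : ∀ c d : NegCommand I, CountdownStep c d → d ∈ carrier → c ∈ carrier

/-! # Orthogonality and propositional domains -/

/-- The data from which orthogonality is defined: opponents of positive terms (the elements of the
negative side, each with an underlying closed term), and which weighted interactions `⟨t|u⟩`
between a positive term and an opponent belong to the pole. -/
structure Frame (I : Pol → Type) (M : Type) : Type 1 where
  Opp : Type
  toTerm : Opp → Term I []
  pole : Set ((PTerm I [] × Opp) × M)

/-- The frame of quantitative realizability for a quantitative pole, that is, for a set of weighted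
closed commands; the negative side consists of the closed negative terms. -/
def quantFrame {I : Pol → Type} {M : Type} (B : Set (Cmd I [] × M)) : Frame I M where
  Opp := Val I .neg []
  toTerm := .neg
  pole := {x | (Cmd.cut x.1.1 x.1.2, x.2) ∈ B}

/-- The frame of countdown-machine realizability.  The negative side consists of the marked terms
`t⊖`, for all closed terms `t` of either polarity, and `⟨u | t⊖⟩` is accepted when the negative
command `⟨t⊖ | u⟩` belongs to the pole.  The realizability is not quantitative: weights lie in the
trivial monoid. -/
def countdownFrame {I : Pol → Type} (B : CountdownPole I) : Frame I Unit where
  Opp := Term I []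
  toTerm := id
  pole := {x | (⟨x.1.2, x.1.1⟩ : NegCommand I) ∈ B.carrier}

namespace Frame

variable {I : Pol → Type} {M : Type}

/-- A set of weighted positive terms, as a set of weighted terms. -/
def ofPos (X : Set (PTerm I [] × M)) : Set (Term I [] × M) :=
  {x | ∃ t p, (t, p) ∈ X ∧ x = (.pos t, p)}

/-- A set of weighted opponents, as a set of weighted terms. -/
def ofNeg (F : Frame I M) (Y : Set (F.Opp × M)) : Set (Term I [] × M) :=
  {x | ∃ t p, (t, p) ∈ Y ∧ x = (F.toTerm t, p)}

/-- The orthogonal of a set of weighted positive terms. -/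
def orth [Add M] (F : Frame I M) (X : Set (PTerm I [] × M)) : Set (F.Opp × M) :=
  {y | ∀ x ∈ X, ((x.1, y.1), x.2 + y.2) ∈ F.pole}

/-- The orthogonal of a set of weighted opponents. -/
def coorth [Add M] (F : Frame I M) (Y : Set (F.Opp × M)) : Set (PTerm I [] × M) :=
  {x | ∀ y ∈ Y, ((x.1, y.1), x.2 + y.2) ∈ F.pole}

/-- `X ⊗ Y`; only values can be put into a pair. -/
def tensor [Add M] (X Y : Set (Term I [] × M)) : Set (PTerm I [] × M) :=
  {x | ∃ (π ϖ : Pol) (V : Val I π []) (W : Val I ϖ []) (p q : M),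
    (V.toTerm, p) ∈ X ∧ (W.toTerm, q) ∈ Y ∧ x = (.val (.pair V W), p + q)}

/-- `↓X`; only values can be put into a one-tuple. -/
def down (X : Set (Term I [] × M)) : Set (PTerm I [] × M) :=
  {x | ∃ (π : Pol) (V : Val I π []) (p : M), (V.toTerm, p) ∈ X ∧ x = (.val (.box V), p)}

/-- `𝒟⊕ ∪ 𝒟⊖`, where `𝒟⊖` consists of the orthogonals of the elements of `𝒟⊕`. -/
def bothSides [Add M] (F : Frame I M) (D : Set (Set (PTerm I [] × M))) :
    Set (Set (Term I [] × M)) :=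
  {Z | ∃ X ∈ D, Z = ofPos X ∨ Z = F.ofNeg (F.orth X)}

end Frame

/-- Positive propositional domains.  (The empty intersection is not taken.) -/
structure PropDomain {I : Pol → Type} {M : Type} [Add M] (F : Frame I M) : Type where
  sets : Set (Set (PTerm I [] × M))
  isValue : ∀ X ∈ sets, ∀ x ∈ X, ∃ V : Val I .pos [], x.1 = .val V
  sUnion_mem : ∀ S ⊆ sets, ⋃₀ S ∈ sets
  sInter_mem : ∀ S ⊆ sets, S.Nonempty → ⋂₀ S ∈ sets
  tensor_mem : ∀ X ∈ F.bothSides sets, ∀ Y ∈ F.bothSides sets, Frame.tensor X Y ∈ sets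
  down_mem : ∀ X ∈ F.bothSides sets, Frame.down X ∈ sets

/-! # Kinds and type constructors -/

/-- Kinds: individuals, positive and negative formulas, functions. -/
inductive Kind : Type where
  | ind : Kind
  | form (π : Pol) : Kind
  | arrow (σ τ : Kind) : Kind
  deriving DecidableEq

/-- Negation of kinds. -/
@[reducible] def Kind.dual : Kind → Kind
  | .ind => .ind
  | .form π => .form π.dual
  | .arrow σ τ => .arrow σ τ.dual

theorem Kind.dual_dual : ∀ σ : Kind, σ.dual.dual = σ
  | .ind => rfl
  | .form .pos => rfl
  | .form .neg => rfl
  | .arrow σ τ => congrArg (Kind.arrow σ) τ.dual_dual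

/-- The kind `τ → (ι → τ → τ) → ι → τ'`. -/
abbrev Kind.recKind (τ τ' : Kind) : Kind :=
  .arrow τ (.arrow (.arrow .ind (.arrow τ τ)) (.arrow .ind τ'))

/-- Higher-order variables: each has a kind and a name. -/
structure CVar : Type where
  kind : Kind
  name : ℕ
  deriving DecidableEq

/-- The well-kinded type constructors of higher-order multiplicative affine logic, extended with
equational implications and with constants from a signature `S`. -/
inductive Constr (S : Kind → Type) : Kind → Type where
  | var (x : CVar) : Constr S x.kind
  | varDual (x : CVar) : Constr S x.kind.dual
  | lam (x : CVar) {τ : Kind} (T : Constr S τ) : Constr S (.arrow x.kind τ)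
  | app {σ τ : Kind} (T : Constr S (.arrow σ τ)) (U : Constr S σ) : Constr S τ
  | zero : Constr S .ind
  | succ : Constr S (.arrow .ind .ind)
  | recur (τ : Kind) : Constr S (.recKind τ τ)
  | recurDual (τ : Kind) : Constr S (.recKind τ τ.dual)
  | tensor {π ϖ : Pol} (A : Constr S (.form π)) (B : Constr S (.form ϖ)) : Constr S (.form .pos)
  | par {π ϖ : Pol} (A : Constr S (.form π)) (B : Constr S (.form ϖ)) : Constr S (.form .neg)
  | ex (x : CVar) {π : Pol} (A : Constr S (.form π)) : Constr S (.form π)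
  | all (x : CVar) {π : Pol} (A : Constr S (.form π)) : Constr S (.form π)
  | down {π : Pol} (A : Constr S (.form π)) : Constr S (.form .pos)
  | up {π : Pol} (A : Constr S (.form π)) : Constr S (.form .neg)
  /-- the equational implication `⟨T = U⟩A` -/
  | eqImp {σ : Kind} (T U : Constr S σ) {π : Pol} (A : Constr S (.form π)) : Constr S (.form π)
  | const {σ : Kind} (k : S σ) : Constr S σ
  | constDual {σ : Kind} (k : S σ) : Constr S σ.dual

namespace Constr

variable {S : Kind → Type}

/-- Involutive negation of constructors. -/
def dual : {σ : Kind} → Constr S σ → Constr S σ.dual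
  | _, var x => varDual x
  | _, varDual x => x.kind.dual_dual.symm ▸ var x
  | _, lam x T => lam x T.dual
  | _, app T U => app T.dual U
  | _, zero => zero
  | _, succ => succ
  | _, recur τ => recurDual τ
  | _, recurDual τ => (Kind.recKind τ τ).dual_dual.symm ▸ recur τ
  | _, tensor A B => par A.dual B.dual
  | _, par A B => tensor A.dual B.dual
  | _, ex x A => all x A.dual
  | _, all x A => ex x A.dual
  | _, down A => up A.dual
  | _, up A => down A.dual
  | _, eqImp T U A => eqImp T U A.dual
  | _, const k => constDual k
  | _, @constDual _ σ k => σ.dual_dual.symm ▸ const k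

/-- The size of a constructor. -/
def size : {σ : Kind} → Constr S σ → ℕ
  | _, var _ => 1
  | _, varDual _ => 1
  | _, lam _ T => T.size + 1
  | _, app T U => T.size + U.size + 1
  | _, zero => 1
  | _, succ => 1
  | _, recur _ => 1
  | _, recurDual _ => 1
  | _, tensor A B => A.size + B.size + 1
  | _, par A B => A.size + B.size + 1
  | _, ex _ A => A.size + 1
  | _, all _ A => A.size + 1
  | _, down A => A.size + 1
  | _, up A => A.size + 1
  | _, eqImp T U A => T.size + U.size + A.size + 1
  | _, const _ => 1
  | _, constDual _ => 1

theorem size_cast {σ τ : Kind} (h : σ = τ) (T : Constr S σ) : (h ▸ T : Constr S τ).size = T.size := by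
  subst h; rfl

theorem size_dual : ∀ {σ : Kind} (T : Constr S σ), T.dual.size = T.size
  | _, var _ => rfl
  | _, varDual _ => size_cast _ _
  | _, lam _ T => by simp only [dual, size, size_dual T]
  | _, app T U => by simp only [dual, size, size_dual T]
  | _, zero => rfl
  | _, succ => rfl
  | _, recur _ => rfl
  | _, recurDual _ => size_cast _ _
  | _, tensor A B => by simp only [dual, size, size_dual A, size_dual B]
  | _, par A B => by simp only [dual, size, size_dual A, size_dual B]
  | _, ex _ A => by simp only [dual, size, size_dual A]
  | _, all _ A => by simp only [dual, size, size_dual A]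
  | _, down A => by simp only [dual, size, size_dual A]
  | _, up A => by simp only [dual, size, size_dual A]
  | _, eqImp _ _ A => by simp only [dual, size, size_dual A]
  | _, const _ => rfl
  | _, constDual _ => size_cast _ _

/-- The linear implication `A ⊸ B = A^⊥ ⅋ B`. -/
def lolli {π ϖ : Pol} (A : Constr S (.form π)) (B : Constr S (.form ϖ)) : Constr S (.form .neg) :=
  par A.dual B

/-- The constructor `s^n 0`. -/
def numeral : ℕ → Constr S .ind
  | 0 => zero
  | n + 1 => app succ (numeral n)

/-- The individual variable with a given name. -/
def indVar (n : ℕ) : Constr S .ind := var ⟨.ind, n⟩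

/-- Addition of individuals, `λp.λq. rec p (λx.s) q`. -/
def add : Constr S (.arrow .ind (.arrow .ind .ind)) :=
  lam ⟨.ind, 0⟩ (lam ⟨.ind, 1⟩
    (app (app (app (recur .ind) (indVar 0)) (lam ⟨.ind, 2⟩ succ)) (indVar 1)))

/-- `T + U`. -/
def plus (T U : Constr S .ind) : Constr S .ind := app (app add T) U

end Constr

/-! # Interpretation of kinds and constructors -/

section Interpretation

variable {I : Pol → Type} {M : Type} [Add M] {F : Frame I M}

/-- The interpretation of a kind: `ℕ`, `𝒟⊕`, `𝒟⊖` and function spaces. -/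
@[reducible] def Den (D : PropDomain F) : Kind → Type
  | .ind => ℕ
  | .form .pos => {X : Set (PTerm I [] × M) // X ∈ D.sets}
  | .form .neg => {Y : Set (F.Opp × M) // ∃ X ∈ D.sets, Y = F.orth X}
  | .arrow σ τ => Den D σ → Den D τ

/-- Total valuations. -/
abbrev TotalVal (D : PropDomain F) : Type := ∀ x : CVar, Den D x.kind

namespace PropDomain

variable (D : PropDomain F)

theorem empty_mem : ∅ ∈ D.sets := by
  simpa using D.sUnion_mem ∅ (Set.empty_subset _)

/-- The empty set, as an element of `𝒟⊕`. -/
def bot : Den D (.form .pos) := ⟨∅, D.empty_mem⟩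

/-- The orthogonal of an element of `𝒟⊕`. -/
def orth (X : Den D (.form .pos)) : Den D (.form .neg) := ⟨F.orth X.1, X.1, X.2, rfl⟩

/-- An element of `𝒟⊕` with a given orthogonal. -/
noncomputable def predual (Y : Den D (.form .neg)) : Den D (.form .pos) :=
  ⟨Y.2.choose, Y.2.choose_spec.1⟩

theorem nonempty_den : ∀ σ : Kind, Nonempty (Den D σ)
  | .ind => ⟨(0 : ℕ)⟩
  | .form .pos => ⟨D.bot⟩
  | .form .neg => ⟨D.orth D.bot⟩
  | .arrow _ τ => ⟨fun _ => (nonempty_den τ).some⟩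

/-- Orthogonality at all kinds.  Elements of `𝒟⊖` are orthogonals of elements of `𝒟⊕`. -/
noncomputable def perp : (σ : Kind) → Den D σ → Den D σ.dual
  | .ind, n => n
  | .form .pos, X => D.orth X
  | .form .neg, Y => D.predual Y
  | .arrow _ τ, f => fun v => perp τ (f v)

/-- The set of weighted terms underlying an element of `𝒟⊕` or `𝒟⊖`. -/
def under : {π : Pol} → Den D (.form π) → Set (Term I [] × M)
  | .pos, X => Frame.ofPos X.1
  | .neg, Y => F.ofNeg Y.1

theorem under_mem : ∀ {π : Pol} (X : Den D (.form π)), D.under X ∈ F.bothSides D.sets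
  | .pos, X => ⟨X.1, X.2, Or.inl rfl⟩
  | .neg, Y => Y.2.elim fun X hX => ⟨X, hX.1, Or.inr (congrArg F.ofNeg hX.2)⟩

/-- `X ⊗ Y`. -/
def tensor {π ϖ : Pol} (X : Den D (.form π)) (Y : Den D (.form ϖ)) : Den D (.form .pos) :=
  ⟨Frame.tensor (D.under X) (D.under Y), D.tensor_mem _ (D.under_mem X) _ (D.under_mem Y)⟩

/-- `↓X`. -/
def down {π : Pol} (X : Den D (.form π)) : Den D (.form .pos) :=
  ⟨Frame.down (D.under X), D.down_mem _ (D.under_mem X)⟩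

/-- The union of a family of elements of `𝒟⊕` indexed by the interpretation of a kind. -/
def union {σ : Kind} (f : Den D σ → Den D (.form .pos)) : Den D (.form .pos) :=
  ⟨⋃₀ Set.range fun v => (f v).1, D.sUnion_mem _ (by rintro _ ⟨v, rfl⟩; exact (f v).2)⟩

/-- The intersection of a family of elements of `𝒟⊕` indexed by the interpretation of a kind. -/
def inter {σ : Kind} (f : Den D σ → Den D (.form .pos)) : Den D (.form .pos) :=
  ⟨⋂₀ Set.range fun v => (f v).1, D.sInter_mem _ (by rintro _ ⟨v, rfl⟩; exact (f v).2)
    ((D.nonempty_den σ).elim fun v => ⟨_, v, rfl⟩)⟩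

/-- The recursor on `ℕ` with values in the interpretation of `τ`. -/
def recur (τ : Kind) : Den D (.recKind τ τ) :=
  fun (a : Den D τ) (f : ℕ → Den D τ → Den D τ) (n : ℕ) => Nat.rec a f n

end PropDomain

/-- The interpretation `|T|` of a constructor under a total valuation, for a given interpretation
`k` of the constants. -/
noncomputable def Constr.interp {S : Kind → Type} (D : PropDomain F) (k : ∀ σ, S σ → Den D σ) :
    {σ : Kind} → Constr S σ → TotalVal D → Den D σ
  | _, var x, ρ => ρ x
  | _, varDual x, ρ => D.perp x.kind (ρ x)
  | _, lam x T, ρ => fun v => T.interp D k (Function.update ρ x v)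
  | _, app T U, ρ => (T.interp D k ρ : _ → _) (U.interp D k ρ)
  | _, zero, _ => (0 : ℕ)
  | _, succ, _ => fun n : ℕ => (n + 1 : ℕ)
  | _, recur τ, _ => D.recur τ
  | _, recurDual τ, _ => D.perp (.recKind τ τ) (D.recur τ)
  | _, tensor A B, ρ => D.tensor (A.interp D k ρ) (B.interp D k ρ)
  | _, par A B, ρ => D.orth (D.tensor (A.dual.interp D k ρ) (B.dual.interp D k ρ))
  | _, @ex _ x .pos A, ρ => D.union fun v => A.interp D k (Function.update ρ x v)
  | _, @ex _ x .neg A, ρ => D.orth (D.inter fun v => A.dual.interp D k (Function.update ρ x v))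
  | _, @all _ x .pos A, ρ => D.inter fun v => A.interp D k (Function.update ρ x v)
  | _, @all _ x .neg A, ρ => D.orth (D.union fun v => A.dual.interp D k (Function.update ρ x v))
  | _, down A, ρ => D.down (A.interp D k ρ)
  | _, up A, ρ => D.orth (D.down (A.dual.interp D k ρ))
  | _, @eqImp _ _ T U .pos A, ρ =>
      open scoped Classical in
      if T.interp D k ρ = U.interp D k ρ then A.interp D k ρ else D.bot
  | _, @eqImp _ _ T U .neg A, ρ =>
      open scoped Classical in
      if T.interp D k ρ = U.interp D k ρ then A.interp D k ρ else D.orth D.bot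
  | _, const c, _ => k _ c
  | _, @constDual _ σ c, _ => D.perp σ (k _ c)
termination_by _ T _ => T.size
decreasing_by
  all_goals simp only [Constr.size, Constr.size_dual]; omega

/-- The set of weighted terms `‖A‖ = |A|^⊥⊥`, given `|A|`. -/
def PropDomain.biorth (D : PropDomain F) : {π : Pol} → Den D (.form π) → Set (Term I [] × M)
  | .pos, X => Frame.ofPos (F.coorth (F.orth X.1))
  | .neg, Y => F.ofNeg (F.orth (F.coorth Y.1))

/-- `(t, p)` realizes the formula `A` under the valuation `ρ`. -/
def Realizes {S : Kind → Type} (D : PropDomain F) (k : ∀ σ, S σ → Den D σ) (ρ : TotalVal D)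
    (t : Term I []) (p : M) {π : Pol} (A : Constr S (.form π)) : Prop :=
  (t, p) ∈ D.biorth (A.interp D k ρ)

end Interpretation

/-! # Multiplicative affine logic and the forcing translation -/

/-- Positive and negative formulas of multiplicative affine logic. -/
inductive MAL : Pol → Type where
  | var (X : ℕ) : MAL .pos
  | varDual (X : ℕ) : MAL .neg
  | tensor {π ϖ : Pol} (A : MAL π) (B : MAL ϖ) : MAL .pos
  | par {π ϖ : Pol} (A : MAL π) (B : MAL ϖ) : MAL .neg
  | down {π : Pol} (A : MAL π) : MAL .pos
  | up {π : Pol} (A : MAL π) : MAL .neg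

namespace MAL

/-- Linear negation. -/
def dual : {π : Pol} → MAL π → MAL π.dual
  | _, var X => varDual X
  | _, varDual X => var X
  | _, tensor A B => par A.dual B.dual
  | _, par A B => tensor A.dual B.dual
  | _, down A => up A.dual
  | _, up A => down A.dual

/-- The variable `X` occurs in the formula. -/
def Occurs (X : ℕ) : {π : Pol} → MAL π → Prop
  | _, var Y => X = Y
  | _, varDual Y => X = Y
  | _, tensor A B => A.Occurs X ∨ B.Occurs X
  | _, par A B => A.Occurs X ∨ B.Occurs X
  | _, down A => A.Occurs X
  | _, up A => A.Occurs X

/-- The size of a formula. -/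
def size : {π : Pol} → MAL π → ℕ
  | _, var _ => 1
  | _, varDual _ => 1
  | _, tensor A B => A.size + B.size + 1
  | _, par A B => A.size + B.size + 1
  | _, down A => A.size + 1
  | _, up A => A.size + 1

theorem size_dual : ∀ {π : Pol} (A : MAL π), A.dual.size = A.size
  | _, var _ => rfl
  | _, varDual _ => rfl
  | _, tensor A B => by simp only [dual, size, size_dual A, size_dual B]
  | _, par A B => by simp only [dual, size, size_dual A, size_dual B]
  | _, down A => by simp only [dual, size, size_dual A]
  | _, up A => by simp only [dual, size, size_dual A]

/-- The higher-order variable, of kind `o⁺`, associated with the variable `X`. -/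
abbrev formVar (X : ℕ) : CVar := ⟨.form .pos, X⟩

/-- The higher-order variable, of kind `ι → o⁺`, associated with the variable `X` by the forcing
translation. -/
abbrev predVar (X : ℕ) : CVar := ⟨.arrow .ind (.form .pos), X⟩

/-- A formula as a type constructor. -/
def toCon {S : Kind → Type} : {π : Pol} → MAL π → Constr S (.form π)
  | _, var X => .var (formVar X)
  | _, varDual X => .varDual (formVar X)
  | _, tensor A B => .tensor A.toCon B.toCon
  | _, par A B => .par A.toCon B.toCon
  | _, down A => .down A.toCon
  | _, up A => .up A.toCon

end MAL

/-- The signature with a single constant `𝒞`, a predicate of kind `ι → o⁺`. -/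
inductive CondSig : Kind → Type where
  | cond : CondSig (.arrow .ind (.form .pos))

/-- The empty signature. -/
inductive NoSig : Kind → Type where

/-- The predicate `𝒞[T]` of the integer forcing structure `(ι, 𝒞, +, 0)`. -/
def condAt (T : Constr CondSig .ind) : Constr CondSig (.form .pos) := .app (.const .cond) T

/-- The forcing orthogonal `λr.∀r'. Z(r') ⊸ 𝒞[r + r']^⊥`.  It is only applied to predicates `Z`
without free variables of kind `ι`. -/
def forcingOrth {π : Pol} (Z : Constr CondSig (.arrow .ind (.form π))) :
    Constr CondSig (.arrow .ind (.form .neg)) :=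
  .lam ⟨.ind, 0⟩ (.all ⟨.ind, 1⟩
    (.lolli (.app Z (.indVar 1)) (condAt (.plus (.indVar 0) (.indVar 1))).dual))

/-- `λr.∃p₁.∃p₂.⟨r = p₁ + p₂⟩(Z(p₁) ⊗ W(p₂))`, for predicates `Z` and `W` without free variables
of kind `ι`. -/
def forcingTensor {π ϖ : Pol} (Z : Constr CondSig (.arrow .ind (.form π)))
    (W : Constr CondSig (.arrow .ind (.form ϖ))) : Constr CondSig (.arrow .ind (.form .pos)) :=
  .lam ⟨.ind, 0⟩ (.ex ⟨.ind, 1⟩ (.ex ⟨.ind, 2⟩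
    (.eqImp (.indVar 0) (.plus (.indVar 1) (.indVar 2))
      (.tensor (.app Z (.indVar 1)) (.app W (.indVar 2))))))

/-- `λr.↓Z(r)`, for a predicate `Z` without free variables of kind `ι`. -/
def forcingDown {π : Pol} (Z : Constr CondSig (.arrow .ind (.form π))) :
    Constr CondSig (.arrow .ind (.form .pos)) :=
  .lam ⟨.ind, 0⟩ (.down (.app Z (.indVar 0)))

/-- The predicate `A*` on conditions. -/
def MAL.star : {π : Pol} → MAL π → Constr CondSig (.arrow .ind (.form π))
  | _, var X => .var (predVar X)
  | _, varDual X => forcingOrth (.var (predVar X) : Constr CondSig (.arrow .ind (.form .pos)))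
  | _, tensor A B => forcingTensor A.star B.star
  | _, par A B => forcingOrth (forcingTensor A.dual.star B.dual.star)
  | _, down A => forcingDown A.star
  | _, up A => forcingOrth (forcingDown A.dual.star)
termination_by _ A => A.size
decreasing_by
  all_goals simp only [MAL.size, MAL.size_dual]; omega

/-- The negative formula `p ⊩_f A`. -/
def MAL.forces (p : Constr CondSig .ind) : {π : Pol} → MAL π → Constr CondSig (.form .neg)
  | .pos, A => .app (forcingOrth (forcingOrth A.star)) p
  | .neg, A => .app A.star p

/-! # The two realizability relations -/

/-- The interpretation `{n̄ | p ≤ n}` of `𝒞[p]` in countdown-machine realizability. -/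
def condSet {I : Pol → Type} (p : ℕ) : Set (PTerm I [] × Unit) :=
  {x | ∃ n : ℕ, p ≤ n ∧ x = (.val (.int n), ())}

/-- The interpretation of the signature of the integer forcing structure. -/
def condInterp {I : Pol → Type} {B : CountdownPole I} (D : PropDomain (countdownFrame B))
    (hD : ∀ p : ℕ, condSet p ∈ D.sets) : ∀ σ : Kind, CondSig σ → Den D σ
  | _, .cond => fun p : ℕ => ⟨condSet p, hD p⟩

/-- The interpretation of the empty signature. -/
def noInterp {I : Pol → Type} {M : Type} [Add M] {F : Frame I M} (D : PropDomain F) :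
    ∀ σ : Kind, NoSig σ → Den D σ :=
  fun _ c => nomatch c

/-- `t` realizes `A` in countdown-machine realizability. -/
def CountdownRealizes {I : Pol → Type} {B : CountdownPole I} (D : PropDomain (countdownFrame B))
    (hD : ∀ p : ℕ, condSet p ∈ D.sets) (ρ : TotalVal D) (t : Term I []) {π : Pol}
    (A : Constr CondSig (.form π)) : Prop :=
  Realizes D (condInterp D hD) ρ t () A

/-- The quantitative pole, over the quantitative monoid `ℕ`, induced by a pole of the countdown
machine: the `(c, p)` such that the forcing command built from `c` and `K` is in the pole for all
`K` in the interpretation of `𝒞[p]`. -/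
def CountdownPole.induced {I : Pol → Type} (B : CountdownPole I) : Set (Cmd I [] × ℕ) :=
  {x | ∀ K ∈ Frame.ofPos (condSet (I := I) x.2), x.1.forcing K.1 ∈ B.carrier}

/-- The set of weighted terms `{(t, p) | t ∈ ρ(X)(p)}`. -/
def TotalVal.induced {I : Pol → Type} {B : CountdownPole I} {D : PropDomain (countdownFrame B)}
    (ρ : TotalVal D) (X : ℕ) : Set (PTerm I [] × ℕ) :=
  {x | (x.1, ()) ∈ ((ρ (MAL.predVar X) : ℕ → Den D (.form .pos)) x.2).1}

/-! # Weakening followed by substitution -/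

theorem Subst.lift_lift_var {I : Pol → Type} {Γ Δ : List Pol} {f : Ren Γ Δ} {s : Subst I Δ Γ}
    (h : ∀ π (κ : TVar Γ π), s π (f π κ) = .var κ) (ϖ : Pol) :
    ∀ π (κ : TVar (ϖ :: Γ) π), s.lift ϖ π (f.lift ϖ π κ) = .var κ
  | _, .zero => rfl
  | _, .succ κ => by simp only [Ren.lift, Subst.lift, h, Val.ren]

mutual

theorem Val.sub_ren_of_leftInverse {I : Pol → Type} : ∀ {π : Pol} {Γ Δ : List Pol} {f : Ren Γ Δ}
    {s : Subst I Δ Γ}, (∀ π (κ : TVar Γ π), s π (f π κ) = .var κ) →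
    ∀ V : Val I π Γ, (V.ren f).sub s = V
  | _, _, _, _, _, h, .var κ => by simp only [Val.ren, Val.sub, h]
  | _, _, _, _, _, _, .inst k => by simp only [Val.ren, Val.sub]
  | _, _, _, _, _, _, .int n => by simp only [Val.ren, Val.sub]
  | _, _, _, _, _, h, .pair V W => by
      simp only [Val.ren, Val.sub, V.sub_ren_of_leftInverse h, W.sub_ren_of_leftInverse h]
  | _, _, _, _, _, h, .box V => by simp only [Val.ren, Val.sub, V.sub_ren_of_leftInverse h]
  | _, _, _, _, _, h, .muPair π ϖ c => by
      simp only [Val.ren, Val.sub, c.sub_ren_of_leftInverse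
        (Subst.lift_lift_var (Subst.lift_lift_var h π) ϖ)]
  | _, _, _, _, _, h, .muBox π c => by
      simp only [Val.ren, Val.sub, c.sub_ren_of_leftInverse (Subst.lift_lift_var h π)]
  | _, _, _, _, _, h, .muPos c => by
      simp only [Val.ren, Val.sub, c.sub_ren_of_leftInverse (Subst.lift_lift_var h .pos)]

theorem PTerm.sub_ren_of_leftInverse {I : Pol → Type} : ∀ {Γ Δ : List Pol} {f : Ren Γ Δ}
    {s : Subst I Δ Γ}, (∀ π (κ : TVar Γ π), s π (f π κ) = .var κ) →
    ∀ t : PTerm I Γ, (t.ren f).sub s = t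
  | _, _, _, _, h, .val V => by simp only [PTerm.ren, PTerm.sub, V.sub_ren_of_leftInverse h]
  | _, _, _, _, h, .mu c => by
      simp only [PTerm.ren, PTerm.sub, c.sub_ren_of_leftInverse (Subst.lift_lift_var h .neg)]

theorem Cmd.sub_ren_of_leftInverse {I : Pol → Type} : ∀ {Γ Δ : List Pol} {f : Ren Γ Δ}
    {s : Subst I Δ Γ}, (∀ π (κ : TVar Γ π), s π (f π κ) = .var κ) →
    ∀ c : Cmd I Γ, (c.ren f).sub s = c
  | _, _, _, _, h, .cut t u => by
      simp only [Cmd.ren, Cmd.sub, t.sub_ren_of_leftInverse h, u.sub_ren_of_leftInverse h]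

end

theorem Cmd.inst1_weaken {I : Pol → Type} {π : Pol} (c : Cmd I []) (V : Val I π []) :
    Cmd.inst1 (c.ren fun _ => .succ) V = c :=
  Cmd.sub_ren_of_leftInverse (fun _ κ => by cases κ) c

/-! # Forcing commands and the induced quantitative pole -/

theorem Val.toTerm_pair_toTerm {I : Pol → Type} {Γ : List Pol} :
    ∀ {π ϖ : Pol} (V : Val I π Γ) (W : Val I ϖ Γ),
      Term.pair V.toTerm W.toTerm = .val (.pair V W)
  | .pos, .pos, _, _ => rfl
  | .pos, .neg, _, _ => rfl
  | .neg, .pos, _, _ => rfl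
  | .neg, .neg, _, _ => rfl

/-- A pair of terms is a value only if it is the pair of two values. -/
theorem Term.pol_of_pair_eq_val {I : Pol → Type} {Γ : List Pol} {π ϖ : Pol} {t u : Term I Γ}
    {V : Val I π Γ} {W : Val I ϖ Γ} (h : Term.pair t u = .val (.pair V W)) : t.pol = π := by
  rcases t with (_ | _) | _ <;> rcases u with (_ | _) | _ <;> simp [Term.pair] at h <;>
    exact h.1

/-- A negative closed term. -/
def Val.someNeg (I : Pol → Type) : Val I .neg [] :=
  .muBox .neg (.cut (.val (.int 0)) (.var .zero))

namespace CountdownPole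

variable {I : Pol → Type} (B : CountdownPole I)

theorem pol_of_counter_mem {t : Term I []} {π : Pol} {V : Val I π []} {n : ℕ}
    (h : NegCommand.counter t V.toTerm (.int n) ∈ B.carrier) : π = t.pol.dual := by
  obtain ⟨t', u, K, hp, e⟩ := B.isForcing _ h
  obtain ⟨rfl, e'⟩ := NegCommand.mk.inj e
  rw [← hp]
  exact (Term.pol_of_pair_eq_val
    (e'.symm.trans (Val.toTerm_pair_toTerm V (.int n : Val I .pos [])))).symm

theorem counter_comm {t u K : Term I []} (h : u.pol = t.pol.dual) :
    NegCommand.counter t u K ∈ B.carrier ↔ NegCommand.counter u t K ∈ B.carrier :=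
  ⟨B.swap t u K h, B.swap u t K (by rw [h]; cases t.pol <;> rfl)⟩

theorem mem_induced {t : PTerm I []} {u : Val I .neg []} {p : ℕ} :
    (Cmd.cut t u, p) ∈ B.induced ↔
      ∀ n, p ≤ n → NegCommand.counter (.neg u) (.pos t) (.int n) ∈ B.carrier := by
  constructor
  · intro h n hn
    exact h (.int n, ()) ⟨_, _, ⟨n, hn, rfl⟩, rfl⟩
  · rintro h _ ⟨_, _, ⟨n, hn, e⟩, rfl⟩
    obtain ⟨rfl, -⟩ := Prod.mk.inj e
    exact h n hn

/-- A command in the quantitative pole yields an opponent of all positive values. -/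
theorem exists_cut_val_mem_induced (h : B.induced.Nonempty) :
    ∃ (u : Val I .neg []) (q : ℕ), ∀ (V : Val I .pos []) (p : ℕ),
      (Cmd.cut (.val V) u, p + q) ∈ B.induced := by
  obtain ⟨⟨⟨t, u⟩, q⟩, hc⟩ := h
  refine ⟨.muPos ((Cmd.cut t u).ren fun _ => .succ), q, fun V p => ?_⟩
  rw [mem_induced] at hc ⊢
  intro n hn
  refine B.antiEval _ _ (.muPos _ V n) ?_
  rw [Cmd.inst1_weaken]
  exact hc n (le_of_add_le_right hn)

end CountdownPole

/-! # Duality and interpretation of constructors -/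

namespace Constr

variable {S : Kind → Type}

theorem rec_heq {σ τ : Kind} (h : σ = τ) (T : Constr S σ) : (h ▸ T : Constr S τ) ≍ T := by
  subst h; rfl

theorem dual_cast_heq {σ τ : Kind} (h : σ = τ) (T : Constr S σ) :
    (h ▸ T : Constr S τ).dual ≍ T.dual := by
  subst h; rfl

theorem heq_tensor {π π' ϖ ϖ' : Pol} (hπ : π' = π) (hϖ : ϖ' = ϖ) {A : Constr S (.form π)}
    {A' : Constr S (.form π')} {B : Constr S (.form ϖ)} {B' : Constr S (.form ϖ')}
    (hA : A' ≍ A) (hB : B' ≍ B) : tensor A' B' = tensor A B := by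
  subst hπ hϖ; rw [eq_of_heq hA, eq_of_heq hB]

theorem heq_par {π π' ϖ ϖ' : Pol} (hπ : π' = π) (hϖ : ϖ' = ϖ) {A : Constr S (.form π)}
    {A' : Constr S (.form π')} {B : Constr S (.form ϖ)} {B' : Constr S (.form ϖ')}
    (hA : A' ≍ A) (hB : B' ≍ B) : par A' B' = par A B := by
  subst hπ hϖ; rw [eq_of_heq hA, eq_of_heq hB]

theorem heq_app {σ τ τ' : Kind} (hτ : τ' = τ) {T : Constr S (.arrow σ τ)}
    {T' : Constr S (.arrow σ τ')} (U : Constr S σ) (h : T' ≍ T) : app T' U ≍ app T U := by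
  subst hτ; rw [eq_of_heq h]

theorem heq_lam (x : CVar) {τ τ' : Kind} (hτ : τ' = τ) {T : Constr S τ} {T' : Constr S τ'}
    (h : T' ≍ T) : lam x T' ≍ lam x T := by
  subst hτ; rw [eq_of_heq h]

theorem dual_dual_heq : ∀ {σ : Kind} (T : Constr S σ), T.dual.dual ≍ T
  | _, var x => rec_heq _ _
  | _, varDual x => dual_cast_heq _ _
  | _, lam x T => heq_lam x (Kind.dual_dual _) T.dual_dual_heq
  | _, app T U => heq_app (Kind.dual_dual _) U T.dual_dual_heq
  | _, zero => .rfl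
  | _, succ => .rfl
  | _, recur τ => rec_heq _ _
  | _, recurDual τ => dual_cast_heq _ _
  | _, @tensor _ π ϖ A B => by
      have hA := A.dual_dual_heq
      have hB := B.dual_dual_heq
      cases π <;> cases ϖ <;> exact heq_of_eq (heq_tensor rfl rfl hA hB)
  | _, @par _ π ϖ A B => by
      have hA := A.dual_dual_heq
      have hB := B.dual_dual_heq
      cases π <;> cases ϖ <;> exact heq_of_eq (heq_par rfl rfl hA hB)
  | _, @ex _ x π A => by
      have hA := A.dual_dual_heq
      cases π <;> exact heq_of_eq (congrArg (ex x) (eq_of_heq hA))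
  | _, @all _ x π A => by
      have hA := A.dual_dual_heq
      cases π <;> exact heq_of_eq (congrArg (all x) (eq_of_heq hA))
  | _, @down _ π A => by
      have hA := A.dual_dual_heq
      cases π <;> exact heq_of_eq (congrArg down (eq_of_heq hA))
  | _, @up _ π A => by
      have hA := A.dual_dual_heq
      cases π <;> exact heq_of_eq (congrArg up (eq_of_heq hA))
  | _, @eqImp _ _ T U π A => by
      have hA := A.dual_dual_heq
      cases π <;> exact heq_of_eq (congrArg (eqImp T U) (eq_of_heq hA))
  | _, const k => rec_heq _ _
  | _, constDual k => dual_cast_heq _ _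

end Constr

theorem MAL.toCon_dual {S : Kind → Type} :
    ∀ {π : Pol} (A : MAL π), (A.toCon : Constr S (.form π)).dual = A.dual.toCon
  | _, .var _ => rfl
  | _, .varDual _ => rfl
  | _, .tensor A B => by simp only [toCon, dual, Constr.dual, A.toCon_dual, B.toCon_dual]
  | _, .par A B => by simp only [toCon, dual, Constr.dual, A.toCon_dual, B.toCon_dual]
  | _, .down A => by simp only [toCon, dual, Constr.dual, A.toCon_dual]
  | _, .up A => by simp only [toCon, dual, Constr.dual, A.toCon_dual]

theorem Pol.dual_dual : ∀ π : Pol, π.dual.dual = π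
  | .pos => rfl
  | .neg => rfl

theorem Constr.dual_lolli_dual {S : Kind → Type} {π : Pol} (A : Constr S (.form π))
    (C : Constr S (.form .pos)) : (lolli A C.dual).dual = tensor A C :=
  heq_tensor π.dual_dual rfl A.dual_dual_heq C.dual_dual_heq

section Interpretation

variable {I : Pol → Type} {M : Type} [Add M] {F : Frame I M}

/-- The interpretation of a constructor does not depend on individual variables. -/
def Constr.IndFree {S : Kind → Type} (D : PropDomain F) (k : ∀ σ, S σ → Den D σ) {σ : Kind}
    (T : Constr S σ) : Prop :=
  ∀ (ρ : TotalVal D) (n v : ℕ),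
    T.interp D k (Function.update ρ ⟨.ind, n⟩ v) = T.interp D k ρ

namespace Constr

variable {S : Kind → Type} {D : PropDomain F}

theorem interp_plus (k : ∀ σ, S σ → Den D σ) (T U : Constr S .ind) (ρ : TotalVal D) :
    (plus T U).interp D k ρ = (T.interp D k ρ + U.interp D k ρ : ℕ) := by
  have rec_succ (a b : ℕ) : (Nat.rec a (fun _ n => n + 1) b : ℕ) = a + b := by
    induction b with
    | zero => rfl
    | succ b ih => exact congrArg (· + 1) ih
  simp only [plus, add, indVar, interp, PropDomain.recur]
  simpa using rec_succ _ _

theorem interp_numeral (k : ∀ σ, S σ → Den D σ) (ρ : TotalVal D) :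
    ∀ p : ℕ, (numeral p : Constr S .ind).interp D k ρ = p
  | 0 => by simp only [numeral, interp]
  | p + 1 => by simp only [numeral, interp, interp_numeral k ρ p]

end Constr

variable {D : PropDomain F} (k : ∀ σ, CondSig σ → Den D σ)

theorem interp_condAt (T : Constr CondSig .ind) (ρ : TotalVal D) :
    (condAt T).interp D k ρ = (k _ .cond : ℕ → Den D (.form .pos)) (T.interp D k ρ) := by
  simp only [condAt, Constr.interp]

theorem interp_forcingOrth {π : Pol} {Z : Constr CondSig (.arrow .ind (.form π))}
    (hZ : Z.IndFree D k) (ρ : TotalVal D) (r : ℕ) :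
    ((forcingOrth Z).interp D k ρ : ℕ → Den D (.form .neg)) r =
      D.orth (D.union (σ := .ind) fun r' : ℕ =>
        D.tensor ((Z.interp D k ρ : ℕ → Den D (.form π)) r')
          ((k _ .cond : ℕ → Den D (.form .pos)) (r + r' : ℕ))) := by
  simp only [forcingOrth, Constr.interp, Constr.dual_lolli_dual, interp_condAt,
    Constr.interp_plus, Constr.indVar]
  congr 2
  funext r'
  congr 1
  exact congrFun ((hZ _ _ _).trans (hZ _ _ _)) _

theorem indFree_forcingOrth {π : Pol} {Z : Constr CondSig (.arrow .ind (.form π))}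
    (hZ : Z.IndFree D k) : (forcingOrth Z).IndFree D k := by
  intro ρ n v
  funext r
  rw [interp_forcingOrth k hZ, interp_forcingOrth k hZ, hZ]

theorem interp_forcingDown {π : Pol} {Z : Constr CondSig (.arrow .ind (.form π))}
    (hZ : Z.IndFree D k) (ρ : TotalVal D) (r : ℕ) :
    ((forcingDown Z).interp D k ρ : ℕ → Den D (.form .pos)) r =
      D.down ((Z.interp D k ρ : ℕ → Den D (.form π)) r) := by
  simp only [forcingDown, Constr.interp, Constr.indVar, hZ _ _ _]
  simp

theorem indFree_forcingDown {π : Pol} {Z : Constr CondSig (.arrow .ind (.form π))}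
    (hZ : Z.IndFree D k) : (forcingDown Z).IndFree D k := by
  intro ρ n v
  funext r
  rw [interp_forcingDown k hZ, interp_forcingDown k hZ, hZ]

open scoped Classical in
theorem interp_forcingTensor {π ϖ : Pol} {Z : Constr CondSig (.arrow .ind (.form π))}
    {W : Constr CondSig (.arrow .ind (.form ϖ))} (hZ : Z.IndFree D k) (hW : W.IndFree D k)
    (ρ : TotalVal D) (r : ℕ) :
    ((forcingTensor Z W).interp D k ρ : ℕ → Den D (.form .pos)) r =
      D.union (σ := .ind) fun p : ℕ => D.union (σ := .ind) fun q : ℕ =>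
        if r = p + q then D.tensor ((Z.interp D k ρ : ℕ → Den D (.form π)) p)
          ((W.interp D k ρ : ℕ → Den D (.form ϖ)) q) else D.bot := by
  simp only [forcingTensor, Constr.interp, Constr.indVar, hZ _ _ _, hW _ _ _,
    Constr.interp_plus]
  simp

theorem indFree_forcingTensor {π ϖ : Pol} {Z : Constr CondSig (.arrow .ind (.form π))}
    {W : Constr CondSig (.arrow .ind (.form ϖ))} (hZ : Z.IndFree D k) (hW : W.IndFree D k) :
    (forcingTensor Z W).IndFree D k := by
  intro ρ n v
  funext r
  rw [interp_forcingTensor k hZ hW, interp_forcingTensor k hZ hW, hZ, hW]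

theorem indFree_predVar (X : ℕ) :
    (Constr.var (MAL.predVar X) : Constr CondSig (.arrow .ind (.form .pos))).IndFree D k := by
  intro ρ n v
  simp only [Constr.interp]
  exact Function.update_of_ne (by simp) _ _

theorem MAL.indFree_star {π : Pol} (A : MAL π) : A.star.IndFree D k := by
  fun_induction MAL.star A with
  | case1 X => exact indFree_predVar k X
  | case2 X => exact indFree_forcingOrth k (indFree_predVar k X)
  | case3 _ _ A B hA hB => exact indFree_forcingTensor k hA hB
  | case4 _ _ A B hA hB => exact indFree_forcingOrth k (indFree_forcingTensor k hA hB)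
  | case5 _ A hA => exact indFree_forcingDown k hA
  | case6 _ A hA => exact indFree_forcingOrth k (indFree_forcingDown k hA)

end Interpretation

/-! # Membership in the interpretations -/

namespace PropDomain

variable {I : Pol → Type} {M : Type} [Add M] {F : Frame I M} (D : PropDomain F)

theorem mem_under_pos {X : Den D (.form .pos)} {t : PTerm I []} {p : M} :
    (Term.pos t, p) ∈ D.under X ↔ (t, p) ∈ X.1 := by
  constructor
  · rintro ⟨t, p, h, e⟩
    cases e
    exact h
  · exact fun h => ⟨t, p, h, rfl⟩

theorem exists_val_of_mem_under {X : Den D (.form .pos)} {t : Term I []} {p : M}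
    (h : (t, p) ∈ D.under X) : ∃ V : Val I .pos [], t = V.toTerm := by
  obtain ⟨t, p, h, e⟩ := h
  cases e
  obtain ⟨V, rfl⟩ := D.isValue _ X.2 _ h
  exact ⟨V, rfl⟩

theorem mem_under_union {σ : Kind} {f : Den D σ → Den D (.form .pos)} {t : Term I []} {p : M} :
    (t, p) ∈ D.under (D.union f) ↔ ∃ v, (t, p) ∈ D.under (f v) := by
  constructor
  · rintro ⟨t, p, ⟨_, ⟨v, rfl⟩, h⟩, e⟩
    exact ⟨v, t, p, h, e⟩
  · rintro ⟨v, t, p, h, e⟩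
    exact ⟨t, p, ⟨_, ⟨v, rfl⟩, h⟩, e⟩

theorem mem_under_bot {t : Term I []} {p : M} : (t, p) ∈ D.under D.bot ↔ False :=
  ⟨fun ⟨_, _, h, _⟩ => h, False.elim⟩

theorem mem_under_tensor {π ϖ : Pol} {X : Den D (.form π)} {Y : Den D (.form ϖ)} {t : Term I []}
    {p : M} : (t, p) ∈ D.under (D.tensor X Y) ↔
      ∃ (π' ϖ' : Pol) (V : Val I π' []) (W : Val I ϖ' []) (q r : M),
        (V.toTerm, q) ∈ D.under X ∧ (W.toTerm, r) ∈ D.under Y ∧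
          t = (Val.pair V W).toTerm ∧ p = q + r := by
  constructor
  · rintro ⟨_, _, ⟨π', ϖ', V, W, q, r, hV, hW, e⟩, e'⟩
    cases e
    cases e'
    exact ⟨π', ϖ', V, W, q, r, hV, hW, rfl, rfl⟩
  · rintro ⟨π', ϖ', V, W, q, r, hV, hW, rfl, rfl⟩
    exact ⟨_, _, ⟨π', ϖ', V, W, q, r, hV, hW, rfl⟩, rfl⟩

theorem mem_under_down {π : Pol} {X : Den D (.form π)} {t : Term I []} {p : M} :
    (t, p) ∈ D.under (D.down X) ↔
      ∃ (π' : Pol) (V : Val I π' []), (V.toTerm, p) ∈ D.under X ∧ t = (Val.box V).toTerm := by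
  constructor
  · rintro ⟨_, _, ⟨π', V, q, hV, e⟩, e'⟩
    cases e
    cases e'
    exact ⟨π', V, hV, rfl⟩
  · rintro ⟨π', V, hV, rfl⟩
    exact ⟨_, _, ⟨π', V, _, hV, rfl⟩, rfl⟩

/-- Negative formulas are closed under biorthogonality. -/
theorem biorth_neg (Y : Den D (.form .neg)) : D.biorth Y = D.under Y := by
  obtain ⟨Y, X, hX, rfl⟩ := Y
  refine congrArg F.ofNeg (Set.Subset.antisymm (fun y hy x hx => hy x ?_) fun y hy x hx => hx y hy)
  exact fun z hz => hz x hx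

end PropDomain

section Countdown

variable {I : Pol → Type} {B : CountdownPole I} (D : PropDomain (countdownFrame B))
  (hD : ∀ p : ℕ, condSet p ∈ D.sets) (E : PropDomain (quantFrame B.induced))

/-- The interpretation of `𝒞[p]`, as an element of the domain. -/
def condDen (p : ℕ) : Den D (.form .pos) := ⟨condSet p, hD p⟩

theorem mem_under_condDen {p : ℕ} {t : Term I []} :
    (t, ()) ∈ D.under (condDen D hD p) ↔ ∃ n, p ≤ n ∧ t = .int n := by
  constructor
  · rintro ⟨_, _, ⟨n, hn, e⟩, e'⟩
    cases e
    cases e'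
    exact ⟨n, hn, rfl⟩
  · rintro ⟨n, hn, rfl⟩
    exact ⟨_, _, ⟨n, hn, rfl⟩, rfl⟩

theorem mem_under_countdown_orth {X : Den D (.form .pos)} {t : Term I []} :
    (t, ()) ∈ D.under (D.orth X) ↔
      ∀ u : PTerm I [], (Term.pos u, ()) ∈ D.under X → (⟨t, u⟩ : NegCommand I) ∈ B.carrier := by
  simp only [D.mem_under_pos]
  constructor
  · rintro ⟨t, _, h, e⟩ u hu
    cases e
    exact h (u, ()) hu
  · exact fun h => ⟨t, (), fun x hx => h x.1 hx, rfl⟩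

/-- The semantic counterpart of `forcingOrth`. -/
def forcingOrthDen {π : Pol} (f : ℕ → Den D (.form π)) (r : ℕ) : Den D (.form .neg) :=
  D.orth (D.union (σ := .ind) fun r' : ℕ => D.tensor (f r') (condDen D hD (r + r')))

/-- The semantic counterpart of `forcingTensor`. -/
noncomputable def forcingTensorDen {π ϖ : Pol} (f : ℕ → Den D (.form π)) (g : ℕ → Den D (.form ϖ))
    (r : ℕ) : Den D (.form .pos) :=
  open scoped Classical in
  D.union (σ := .ind) fun p : ℕ => D.union (σ := .ind) fun q : ℕ =>
    if r = p + q then D.tensor (f p) (g q) else D.bot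

theorem mem_under_forcingOrthDen {π : Pol} {f : ℕ → Den D (.form π)} {r : ℕ} {t : Term I []} :
    (t, ()) ∈ D.under (forcingOrthDen D hD f r) ↔
      ∀ (r' : ℕ) (ϖ : Pol) (V : Val I ϖ []), (V.toTerm, ()) ∈ D.under (f r') →
        ∀ n, r + r' ≤ n → NegCommand.counter t V.toTerm (.int n) ∈ B.carrier := by
  have hc (ϖ : Pol) (V : Val I ϖ []) (n : ℕ) :
      NegCommand.counter t V.toTerm (.int n) = ⟨t, .val (.pair V (.int n))⟩ :=
    congrArg (NegCommand.mk t) (V.toTerm_pair_toTerm (.int n : Val I .pos []))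
  rw [forcingOrthDen, mem_under_countdown_orth]
  simp only [PropDomain.mem_under_union, PropDomain.mem_under_tensor, hc]
  constructor
  · intro h r' ϖ V hV n hn
    exact h _ ⟨r', ϖ, .pos, V, .int n, (), (), hV, (mem_under_condDen D hD).2 ⟨n, hn, rfl⟩, rfl, trivial⟩
  · rintro h u ⟨r', ϖ, π', V, W, _, _, hV, hW, hu, -⟩
    obtain ⟨n, hn, hW⟩ := (mem_under_condDen D hD).1 hW
    cases π' with
    | neg => cases hW
    | pos =>
      cases hW
      cases hu
      exact h r' ϖ V hV n hn

theorem mem_under_forcingTensorDen {π ϖ : Pol} {f : ℕ → Den D (.form π)}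
    {g : ℕ → Den D (.form ϖ)} {r : ℕ} {t : Term I []} :
    (t, ()) ∈ D.under (forcingTensorDen D f g r) ↔
      ∃ (π' ϖ' : Pol) (V : Val I π' []) (W : Val I ϖ' []) (p q : ℕ),
        (V.toTerm, ()) ∈ D.under (f p) ∧ (W.toTerm, ()) ∈ D.under (g q) ∧
          t = (Val.pair V W).toTerm ∧ r = p + q := by
  simp only [forcingTensorDen, PropDomain.mem_under_union]
  constructor
  · rintro ⟨p, q, h⟩
    split_ifs at h with hr
    · obtain ⟨π', ϖ', V, W, _, _, hV, hW, ht, -⟩ := D.mem_under_tensor.1 h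
      exact ⟨π', ϖ', V, W, p, q, hV, hW, ht, hr⟩
    · exact (D.mem_under_bot.1 h).elim
  · rintro ⟨π', ϖ', V, W, p, q, hV, hW, ht, hr⟩
    refine ⟨p, q, ?_⟩
    rw [if_pos hr, D.mem_under_tensor]
    exact ⟨π', ϖ', V, W, (), (), hV, hW, ht, rfl⟩

theorem pos_notMem_under_quant_neg {Y : Den E (.form .neg)} {t : PTerm I []} {p : ℕ} :
    (Term.pos t, p) ∉ E.under Y := by
  rintro ⟨_, _, _, e⟩
  cases e

theorem mem_under_quant_orth {X : Den E (.form .pos)} {u : Val I .neg []} {p : ℕ} :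
    (Term.neg u, p) ∈ E.under (E.orth X) ↔
      ∀ (V : Val I .pos []) (q : ℕ), (V.toTerm, q) ∈ E.under X →
        (Cmd.cut (.val V) u, p + q) ∈ B.induced := by
  constructor
  · rintro ⟨u, p, h, e⟩ V q hV
    cases e
    rw [add_comm]
    exact h (_, q) (E.mem_under_pos.1 hV)
  · refine fun h => ⟨u, p, fun ⟨x, q⟩ hx => ?_, rfl⟩
    obtain ⟨V, rfl⟩ := E.isValue _ X.2 _ hx
    have := h V q (E.mem_under_pos.2 hx)
    rwa [add_comm] at this

theorem mem_biorth_quant_pos {X : Den E (.form .pos)} {t : PTerm I []} {p : ℕ} :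
    (Term.pos t, p) ∈ E.biorth X ↔
      ∀ (u : Val I .neg []) (q : ℕ), (Term.neg u, q) ∈ E.under (E.orth X) →
        (Cmd.cut t u, p + q) ∈ B.induced := by
  constructor
  · rintro ⟨t, p, h, e⟩ u q ⟨u, q, hu, e'⟩
    cases e
    cases e'
    exact h (u, q) hu
  · exact fun h => ⟨t, p, fun y hy => h y.1 y.2 ⟨_, _, hy, rfl⟩, rfl⟩

/-! # Comparison of the two interpretations -/

variable {D E}

/-- A predicate `f` on conditions and a quantitative formula `G` agree: they have the same negative
elements, one is inhabited by values iff the other is, and they are inhabited and have the same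
elements if the quantitative pole is not empty. -/
structure Agree {π : Pol} (f : ℕ → Den D (.form π)) (G : Den E (.form π)) : Prop where
  neg_iff : ∀ (u : Val I .neg []) (p : ℕ),
    (Term.neg u, p) ∈ E.under G ↔ (Term.neg u, ()) ∈ D.under (f p)
  inhabited_iff : (∃ (ϖ : Pol) (V : Val I ϖ []) (p : ℕ), (V.toTerm, p) ∈ E.under G) ↔
    ∃ (ϖ : Pol) (V : Val I ϖ []) (p : ℕ), (V.toTerm, ()) ∈ D.under (f p)
  mem_iff : B.induced.Nonempty →
    ∀ (t : Term I []) (p : ℕ), (t, p) ∈ E.under G ↔ (t, ()) ∈ D.under (f p)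
  inhabited : B.induced.Nonempty →
    ∃ (ϖ : Pol) (V : Val I ϖ []) (p : ℕ), (V.toTerm, p) ∈ E.under G

namespace Agree

theorem neg_iff_of_pos {f : ℕ → Den D (.form .pos)} {G : Den E (.form .pos)} (u : Val I .neg [])
    (p : ℕ) : (Term.neg u, p) ∈ E.under G ↔ (Term.neg u, ()) ∈ D.under (f p) := by
  constructor <;> rintro ⟨_, _, _, e⟩ <;> cases e

theorem of_forall_mem_iff {f : ℕ → Den D (.form .pos)} {G : Den E (.form .pos)}
    (h : ∀ (t : PTerm I []) (p : ℕ), (t, p) ∈ G.1 ↔ (t, ()) ∈ (f p).1) (hG : G.1.Nonempty) :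
    Agree f G := by
  have hm (t : Term I []) (p : ℕ) : (t, p) ∈ E.under G ↔ (t, ()) ∈ D.under (f p) := by
    cases t with
    | pos t => rw [E.mem_under_pos, D.mem_under_pos, h]
    | neg t => exact neg_iff_of_pos t p
  refine ⟨neg_iff_of_pos, by simp only [hm], fun _ => hm, fun _ => ?_⟩
  obtain ⟨⟨x, p⟩, hx⟩ := hG
  obtain ⟨V, rfl⟩ := E.isValue _ G.2 _ hx
  exact ⟨.pos, V, p, E.mem_under_pos.2 hx⟩

theorem tensor {π ϖ : Pol} {f : ℕ → Den D (.form π)} {G : Den E (.form π)}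
    {g : ℕ → Den D (.form ϖ)} {H : Den E (.form ϖ)} (hf : Agree f G) (hg : Agree g H) :
    Agree (forcingTensorDen D f g) (E.tensor G H) := by
  have inh : (∃ (ϖ : Pol) (V : Val I ϖ []) (p : ℕ), (V.toTerm, p) ∈ E.under (E.tensor G H)) ↔
      (∃ (ϖ : Pol) (V : Val I ϖ []) (p : ℕ), (V.toTerm, p) ∈ E.under G) ∧
        ∃ (ϖ : Pol) (V : Val I ϖ []) (p : ℕ), (V.toTerm, p) ∈ E.under H := by
    simp only [E.mem_under_tensor]
    constructor
    · rintro ⟨_, _, _, π', ϖ', V, W, p, q, hV, hW, -, -⟩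
      exact ⟨⟨π', V, p, hV⟩, ϖ', W, q, hW⟩
    · rintro ⟨⟨π', V, p, hV⟩, ϖ', W, q, hW⟩
      exact ⟨.pos, .pair V W, p + q, π', ϖ', V, W, p, q, hV, hW, rfl, rfl⟩
  refine ⟨neg_iff_of_pos, ?_, fun hB t p => ?_,
    fun hB => inh.2 ⟨hf.inhabited hB, hg.inhabited hB⟩⟩
  · rw [inh, hf.inhabited_iff, hg.inhabited_iff]
    simp only [mem_under_forcingTensorDen]
    constructor
    · rintro ⟨⟨π', V, p, hV⟩, ϖ', W, q, hW⟩
      exact ⟨.pos, .pair V W, p + q, π', ϖ', V, W, p, q, hV, hW, rfl, rfl⟩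
    · rintro ⟨_, _, _, π', ϖ', V, W, p, q, hV, hW, -, -⟩
      exact ⟨⟨π', V, p, hV⟩, ϖ', W, q, hW⟩
  · simp only [mem_under_forcingTensorDen, E.mem_under_tensor, hf.mem_iff hB, hg.mem_iff hB]

theorem down {π : Pol} {f : ℕ → Den D (.form π)} {G : Den E (.form π)} (hf : Agree f G) :
    Agree (fun r => D.down (f r)) (E.down G) := by
  refine ⟨neg_iff_of_pos, ?_, fun hB t p => ?_, fun hB => ?_⟩
  · simp only [E.mem_under_down, D.mem_under_down]
    constructor
    · rintro ⟨_, _, p, π', V, hV, -⟩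
      obtain ⟨ϖ, W, q, hW⟩ := hf.inhabited_iff.1 ⟨π', V, p, hV⟩
      exact ⟨.pos, .box W, q, ϖ, W, hW, rfl⟩
    · rintro ⟨_, _, p, π', V, hV, -⟩
      obtain ⟨ϖ, W, q, hW⟩ := hf.inhabited_iff.2 ⟨π', V, p, hV⟩
      exact ⟨.pos, .box W, q, ϖ, W, hW, rfl⟩
  · simp only [E.mem_under_down, D.mem_under_down, hf.mem_iff hB]
  · obtain ⟨ϖ, W, q, hW⟩ := hf.inhabited hB
    exact ⟨.pos, .box W, q, E.mem_under_down.2 ⟨ϖ, W, hW, rfl⟩⟩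

theorem orth {f : ℕ → Den D (.form .pos)} {G : Den E (.form .pos)} (hf : Agree f G) :
    Agree (forcingOrthDen D hD f) (E.orth G) := by
  have neg_iff (u : Val I .neg []) (p : ℕ) : (Term.neg u, p) ∈ E.under (E.orth G) ↔
      (Term.neg u, ()) ∈ D.under (forcingOrthDen D hD f p) := by
    rw [mem_under_quant_orth, mem_under_forcingOrthDen]
    by_cases hB : B.induced.Nonempty
    · simp only [B.mem_induced, hf.mem_iff hB]
      refine ⟨fun h r' ϖ V hV => ?_, fun h V q hV => h q .pos V hV⟩
      obtain ⟨W, e⟩ := D.exists_val_of_mem_under hV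
      rw [e] at hV ⊢
      exact h W r' hV
    · constructor
      · intro h r' ϖ V hV
        obtain ⟨ϖ', W, q, hW⟩ := hf.inhabited_iff.2 ⟨ϖ, V, r', hV⟩
        obtain ⟨W', e⟩ := E.exists_val_of_mem_under hW
        exact (hB ⟨_, h W' q (e ▸ hW)⟩).elim
      · intro h V q hV
        obtain ⟨ϖ', W, r', hW⟩ := hf.inhabited_iff.1 ⟨.pos, V, q, hV⟩
        obtain ⟨W', e⟩ := D.exists_val_of_mem_under hW
        exact (hB ⟨_, B.mem_induced.2 (h r' .pos W' (e ▸ hW))⟩).elim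
  have not_inhabited {t : PTerm I []} {p : ℕ}
      (ht : (Term.pos t, ()) ∈ D.under (forcingOrthDen D hD f p)) :
      ¬ ∃ (ϖ : Pol) (V : Val I ϖ []) (p : ℕ), (V.toTerm, p) ∈ E.under G := by
    rw [hf.inhabited_iff]
    rintro ⟨ϖ, V, r', hV⟩
    obtain ⟨W, e⟩ := D.exists_val_of_mem_under hV
    rw [e] at hV
    cases B.pol_of_counter_mem ((mem_under_forcingOrthDen D hD).1 ht r' .pos W hV _ le_rfl)
  refine ⟨neg_iff, ⟨?_, ?_⟩, fun hB t p => ?_, fun hB => ?_⟩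
  · rintro ⟨ϖ, V, p, hV⟩
    cases ϖ with
    | pos => exact (pos_notMem_under_quant_neg E hV).elim
    | neg => exact ⟨.neg, V, p, (neg_iff V p).1 hV⟩
  · rintro ⟨ϖ, V, p, hV⟩
    cases ϖ with
    | neg => exact ⟨.neg, V, p, (neg_iff V p).2 hV⟩
    | pos =>
      refine ⟨.neg, .someNeg I, p, (mem_under_quant_orth E).2 fun W q hW => ?_⟩
      exact (not_inhabited hV ⟨.pos, W, q, hW⟩).elim
  · cases t with
    | neg u => exact neg_iff u p
    | pos t =>
      exact iff_of_false (pos_notMem_under_quant_neg E) fun h => not_inhabited h (hf.inhabited hB)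
  · obtain ⟨u, q, h⟩ := B.exists_cut_val_mem_induced hB
    refine ⟨.neg, u, q, (mem_under_quant_orth E).2 fun V p _ => ?_⟩
    rw [add_comm]
    exact h V p

theorem mem_forcingOrth_orth_iff {f : ℕ → Den D (.form .pos)} {G : Den E (.form .pos)}
    (hf : Agree f G) {t : Term I []} (ht : B.induced.Nonempty ∨ t.pol = .pos) (p : ℕ) :
    (t, ()) ∈ D.under (forcingOrthDen D hD (forcingOrthDen D hD f) p) ↔ (t, p) ∈ E.biorth G := by
  have ho := hf.orth hD
  cases t with
  | neg t =>
    refine iff_of_false (fun h => ?_) (by rintro ⟨_, _, _, e⟩; cases e)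
    rw [mem_under_forcingOrthDen] at h
    obtain hB | e := ht
    · obtain ⟨ϖ, V, q, hV⟩ := ho.inhabited hB
      cases ϖ with
      | pos => exact pos_notMem_under_quant_neg E hV
      | neg => cases B.pol_of_counter_mem (h q .neg V ((ho.neg_iff V q).1 hV) _ le_rfl)
    · cases e
  | pos t =>
    rw [mem_under_forcingOrthDen, mem_biorth_quant_pos]
    constructor
    · intro h u q hu
      rw [B.mem_induced]
      exact fun n hn => (B.counter_comm rfl).1 (h q .neg u ((ho.neg_iff u q).1 hu) n hn)
    · intro h r' ϖ V hV n hn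
      cases ϖ with
      | neg =>
        exact (B.counter_comm rfl).1 (B.mem_induced.1 (h V r' ((ho.neg_iff V r').2 hV)) n hn)
      | pos =>
        exfalso
        by_cases hB : B.induced.Nonempty
        · exact pos_notMem_under_quant_neg E ((ho.mem_iff hB _ _).2 hV)
        · obtain ⟨ϖ, W, q, hW⟩ := ho.inhabited_iff.2 ⟨.pos, V, r', hV⟩
          cases ϖ with
          | pos => exact pos_notMem_under_quant_neg E hW
          | neg => exact hB ⟨_, h W q hW⟩

end Agree

theorem MAL.occurs_dual (X : ℕ) : ∀ {π : Pol} (A : MAL π), A.dual.Occurs X ↔ A.Occurs X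
  | _, .var _ => .rfl
  | _, .varDual _ => .rfl
  | _, .tensor A B => or_congr (A.occurs_dual X) (B.occurs_dual X)
  | _, .par A B => or_congr (A.occurs_dual X) (B.occurs_dual X)
  | _, .down A => A.occurs_dual X
  | _, .up A => A.occurs_dual X

variable {ρ : TotalVal D} {η : TotalVal E}

theorem agree_var (hη : ∀ X : ℕ, (η (MAL.formVar X) : Den E (.form .pos)).1 = ρ.induced X) {X : ℕ}
    (hX : (ρ.induced X).Nonempty) :
    Agree (D := D) (E := E) (π := .pos) (ρ (MAL.predVar X)) (η (MAL.formVar X)) := by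
  refine .of_forall_mem_iff (fun t p => ?_) ?_
  · rw [hη]; rfl
  · rwa [hη]

theorem MAL.agree_star
    (hη : ∀ X : ℕ, (η (MAL.formVar X) : Den E (.form .pos)).1 = ρ.induced X) {π : Pol}
    (A : MAL π) (hA : ∀ X : ℕ, A.Occurs X → (ρ.induced X).Nonempty) :
    Agree (A.star.interp D (condInterp D hD) ρ : ℕ → Den D (.form π))
      (A.toCon.interp E (noInterp E) η) := by
  have orth_eq {ϖ : Pol} {Z : Constr CondSig (.arrow .ind (.form ϖ))}
      (hZ : Z.IndFree D (condInterp D hD)) :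
      ((forcingOrth Z).interp D (condInterp D hD) ρ : ℕ → Den D (.form .neg)) =
        forcingOrthDen D hD (Z.interp D (condInterp D hD) ρ) :=
    funext (interp_forcingOrth _ hZ ρ)
  have tensor_eq {ϖ ϖ' : Pol} {Z : Constr CondSig (.arrow .ind (.form ϖ))}
      {W : Constr CondSig (.arrow .ind (.form ϖ'))}
      (hZ : Z.IndFree D (condInterp D hD)) (hW : W.IndFree D (condInterp D hD)) :
      ((forcingTensor Z W).interp D (condInterp D hD) ρ : ℕ → Den D (.form .pos)) =
        forcingTensorDen D (Z.interp D (condInterp D hD) ρ) (W.interp D (condInterp D hD) ρ) :=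
    funext (interp_forcingTensor _ hZ hW ρ)
  have down_eq {ϖ : Pol} {Z : Constr CondSig (.arrow .ind (.form ϖ))}
      (hZ : Z.IndFree D (condInterp D hD)) :
      ((forcingDown Z).interp D (condInterp D hD) ρ : ℕ → Den D (.form .pos)) =
        fun r => D.down ((Z.interp D (condInterp D hD) ρ : ℕ → Den D (.form ϖ)) r) :=
    funext (interp_forcingDown _ hZ ρ)
  fun_induction MAL.star A with
  | case1 X =>
    simp only [toCon, Constr.interp]
    exact agree_var hη (hA X rfl)
  | case2 X =>
    rw [orth_eq (indFree_predVar _ X)]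
    simp only [toCon, Constr.interp]
    exact (agree_var hη (hA X rfl)).orth hD
  | case3 _ _ A B ihA ihB =>
    rw [tensor_eq (indFree_star _ A) (indFree_star _ B)]
    simp only [toCon, Constr.interp]
    exact (ihA fun X h => hA X (.inl h)).tensor (ihB fun X h => hA X (.inr h))
  | case4 _ _ A B ihA ihB =>
    rw [orth_eq (indFree_forcingTensor _ (indFree_star _ A.dual) (indFree_star _ B.dual)),
      tensor_eq (indFree_star _ A.dual) (indFree_star _ B.dual)]
    simp only [toCon, Constr.interp, toCon_dual]
    exact ((ihA fun X h => hA X (.inl ((occurs_dual X A).1 h))).tensor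
      (ihB fun X h => hA X (.inr ((occurs_dual X B).1 h)))).orth hD
  | case5 _ A ihA =>
    rw [down_eq (indFree_star _ A)]
    simp only [toCon, Constr.interp]
    exact (ihA hA).down
  | case6 _ A ihA =>
    rw [orth_eq (indFree_forcingDown _ (indFree_star _ A.dual)), down_eq (indFree_star _ A.dual)]
    simp only [toCon, Constr.interp, toCon_dual]
    exact (ihA fun X h => hA X ((occurs_dual X A).1 h)).down.orth hD

end Countdown

/-- The connection theorem: countdown-machine realizability of the integer linear forcing
translation of a MAL formula is quantitative realizability of the formula. -/
theorem mainTheorem4 {I : Pol → Type} (B : CountdownPole I)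
    (D : PropDomain (countdownFrame B)) (hD : ∀ p : ℕ, condSet p ∈ D.sets) (ρ : TotalVal D)
    (E : PropDomain (quantFrame B.induced)) (η : TotalVal E)
    (hη : ∀ X : ℕ, (η (MAL.formVar X) : Den E (.form .pos)).1 = ρ.induced X)
    {π : Pol} (C : MAL π) (hC : ∀ X : ℕ, C.Occurs X → (ρ.induced X).Nonempty)
    (t : Term I []) (ht : B.induced.Nonempty ∨ t.pol = π) (p : ℕ) :
    CountdownRealizes D hD ρ t (C.forces (.numeral p)) ↔
      Realizes E (noInterp E) η t p C.toCon := by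
  have hag := C.agree_star hD hη hC
  rw [CountdownRealizes, Realizes, Realizes]
  cases π with
  | pos =>
    rw [PropDomain.biorth_neg]
    simp only [MAL.forces, Constr.interp, Constr.interp_numeral]
    have hfree := C.indFree_star (condInterp D hD)
    rw [interp_forcingOrth _ (indFree_forcingOrth _ hfree)]
    have h : ((forcingOrth C.star).interp D (condInterp D hD) ρ : ℕ → Den D (.form .neg)) =
        forcingOrthDen D hD (C.star.interp D (condInterp D hD) ρ) :=
      funext (interp_forcingOrth _ hfree ρ)
    rw [h]
    exact hag.mem_forcingOrth_orth_iff hD ht p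
  | neg =>
    rw [PropDomain.biorth_neg, PropDomain.biorth_neg]
    simp only [MAL.forces, Constr.interp, Constr.interp_numeral]
    obtain hB | hp := ht
    · exact (hag.mem_iff hB t p).symm
    · cases t with
      | pos t => cases hp
      | neg u => exact (hag.neg_iff u p).symm
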